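/- Let $A\not\equiv 0$ be a polynomial, $q$ an entire function, $\mathbb T=\{|z|=1\}$, and let $\mathcal Z_A$ be the (finite) zero set of $zA(z)$. Let $\nu$ be a generalized semiclassical weight: $\nu$ is a holomorphic, nowhere vanishing function on an open set $\Omega$ with $\mathbb T\setminus\mathcal Z_A\subseteq\Omega\subseteq\mathbb C\setminus\mathcal Z_A$ (so $\Omega=\mathbb C\setminus\mathcal Z_A$ if $\nu$ is single-valued, and otherwise branch cuts are removed), and $$zA(z)\,\nu'(z)=q(z)\,\nu(z),\qquad z\in\Omega .$$ The weight also has values at the points of $\mathbb T\cap\mathcal Z_A$ where it is not singular. Let $S\subseteq\mathbb T\cap\mathcal Z_A$ be the set of singular points of the weight on $\mathbb T$ ($S=\emptyset$ for a Hölder continuous weight). Let $n\ge 0$ be an integer and let $Y_n$ be a $2\times2$ matrix function that solves the Riemann–Hilbert problem: 1. $Y_n$ is holomorphic in $\mathbb C\setminus\mathbb T$; 2. $Y_n$ has continuous boundary values $(Y_n)_+$ (from $|z|<1$) and $(Y_n)_-$ (from $|z|>1$) on $\mathbb T\setminus S$, with $(Y_n)_+(t)=(Y_n)_-(t)\begin{bmatrix}1&\nu(t)/t^n\\0&1\end{bmatrix}$;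 as $z\to c\in S$, $z\notin\mathbb T$, the first column of $Y_n$ is $O(1)$ and the second one is $o(|z-c|^{-1})$; 3. $Y_n(z)=\big(I_2+O(z^{-1})\big)\begin{bmatrix}z^n&0\\0&z^{-n}\end{bmatrix}$ as $z\to\infty$. Put $Z_n=Y_nC_n$ with $C_n(z)=\begin{bmatrix}z^{-n/2}\nu(z)^{1/2}&0\\0&z^{n/2}\nu(z)^{-1/2}\end{bmatrix}$, for any local holomorphic branches of the square roots. Then, at every point of $\Omega\setminus\mathbb T$, $Z_n$ is differentiable and invertible, and the structure matrix $M_n=Z_n'Z_n^{-1}$ does not depend on the branches and extends to a function that is holomorphic in $\mathbb C\setminus\mathcal Z_A$. In particular, $M_n$ has at most an isolated singularity at each point of $\mathcal Z_A$. -/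

import Mathlib

open Filter Topology Asymptotics

namespace UnitCircleRH

/-- The unit circle `𝕋`. -/
abbrev circ : Set ℂ := Metric.sphere (0 : ℂ) 1

/-- The zero set of the polynomial `z A(z)`. -/
def zeroSet (A : Polynomial ℂ) : Set ℂ := {z | z * A.eval z = 0}

/-- `ν` is a generalized semiclassical weight: `z A(z) ν'(z) = q(z) ν(z)` off the zeros of `z A(z)`,
with `A` a (nonzero) polynomial and `q` entire.

`ν` may be multivalued in the plane (for example `(-z)^β (1 - z)^α`), so it is given as a
holomorphic nowhere vanishing branch on an open set `Ω` that avoids the zeros of `z A(z)` and contains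
every other point of the circle.  If `ν` is single-valued, `Ω` is the whole complement of
`zeroSet A`; in general it is this complement with branch cuts removed.  On `Ω ∩ 𝕋` the function `ν` is
the weight of orthogonality itself. -/
structure IsGeneralizedSemiclassical (A : Polynomial ℂ) (q ν : ℂ → ℂ) (Ω : Set ℂ) : Prop where
  ne_zero : A ≠ 0
  entire : Differentiable ℂ q
  isOpen : IsOpen Ω
  subset_compl : Ω ⊆ (zeroSet A)ᶜ
  circ_subset : circ \ zeroSet A ⊆ Ω
  holomorphic : DifferentiableOn ℂ ν Ω
  weight_ne_zero : ∀ z ∈ Ω, ν z ≠ 0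
  pearson : ∀ z ∈ Ω, z * A.eval z * deriv ν z = q z * ν z

/-- `Y` solves the Riemann–Hilbert problem of index `n` for the weight `ν` on the unit circle.
`S` is the set of points of the circle at which the weight is singular; for a Hölder continuous
weight `S = ∅`, and `jump` is then required on the whole circle and `endpoint` is void.  At a singular
point of the weight there are no boundary values, and the customary local condition takes their
place: the first column stays bounded, and the second one (a Cauchy integral of the
weight) is `o(1/|z - c|)`, as is the case for every singularity `|z - c| ^ a` with `-1 < a`. -/
structure IsRHSolution (n : ℕ) (ν : ℂ → ℂ) (S : Set ℂ) (Y : ℂ → Matrix (Fin 2) (Fin 2) ℂ) :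
    Prop where
  holomorphic : ∀ i j, DifferentiableOn ℂ (fun z => Y z i j) circᶜ
  jump : ∃ Yp Ym : ℂ → Matrix (Fin 2) (Fin 2) ℂ,
    ContinuousOn Yp (circ \ S) ∧ ContinuousOn Ym (circ \ S) ∧
    ∀ t ∈ circ \ S,
      Tendsto Y (𝓝[{z | ‖z‖ < 1}] t) (𝓝 (Yp t)) ∧
      Tendsto Y (𝓝[{z | 1 < ‖z‖}] t) (𝓝 (Ym t)) ∧
      Yp t = Ym t * !![1, ν t / t ^ n; 0, 1]
  endpoint : ∀ c ∈ S, ∀ i,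
    (fun z => Y z i 0) =O[𝓝[circᶜ] c] (fun _ => (1 : ℂ)) ∧
    (fun z => Y z i 1) =o[𝓝[circᶜ] c] (fun z => (z - c)⁻¹)
  infinity : ∃ R : ℂ → Matrix (Fin 2) (Fin 2) ℂ,
    (∀ i j, (fun z => R z i j) =O[Bornology.cobounded ℂ] (fun z => z⁻¹)) ∧
    ∀ᶠ z in Bornology.cobounded ℂ, Y z = (1 + R z) * !![z ^ n, 0; 0, (z ^ n)⁻¹]

/-- `r` is, near `z`, a holomorphic branch of the square root of `f`. -/
def IsSqrtBranchAt (f r : ℂ → ℂ) (z : ℂ) : Prop :=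
  AnalyticAt ℂ r z ∧ ∀ᶠ w in 𝓝 z, r w ^ 2 = f w

/-- The matrix `C_n(z) = diag (z^{-n/2} / ν^{-1/2}, z^{n/2} / ν^{1/2})`, where `r` is a branch of
`z^{1/2}` and `s` a branch of `ν^{1/2}`. -/
noncomputable def cMatrix (n : ℕ) (r s : ℂ → ℂ) (z : ℂ) : Matrix (Fin 2) (Fin 2) ℂ :=
  !![(r z ^ n)⁻¹ / (s z)⁻¹, 0; 0, r z ^ n / s z]

/-- The fundamental matrix `Z_n = Y_n C_n`. -/
noncomputable def zMatrix (n : ℕ) (Y : ℂ → Matrix (Fin 2) (Fin 2) ℂ) (r s : ℂ → ℂ) (z : ℂ) :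
    Matrix (Fin 2) (Fin 2) ℂ :=
  Y z * cMatrix n r s z

/-- The entrywise complex derivative of a matrix function. -/
noncomputable def matDeriv (Z : ℂ → Matrix (Fin 2) (Fin 2) ℂ) (z : ℂ) :
    Matrix (Fin 2) (Fin 2) ℂ :=
  Matrix.of fun i j => deriv (fun w => Z w i j) z

end UnitCircleRH

open UnitCircleRH

/-! Put `α = z^{-n/2} ν^{1/2}`, so `C_n = diag(α, α⁻¹)`. The Pearson equation gives `α' = g α` with
`g = (q/(zA) - n/z)/2`, which is free of branches. Since `det Y = 1` (`IsRHSolution.det_eq_one`, by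
Liouville), `M_n = Y' adj Y + g Y diag(1,-1) adj Y`, the `twistedLogDeriv`. This is holomorphic off
the circle and off the zeros of `zA`, even on branch cuts of `ν`.

To cross the circle, note that the jump entry `h = ν/z^n = α²` is holomorphic on `Ω` and satisfies
`h' = 2 g h`. Undoing the jump outside the disk therefore continues `Y` holomorphically over `Ω`
(`IsRHSolution.differentiableOn_continuation`, by Painlevé), and it does not alter the twisted
derivative (`twistedLogDeriv_mul_unipotent`). -/

namespace UnitCircleRH

/-! ### Painlevé's theorem: from a line to the circle -/

theorem differentiableOn_of_continuousOn_of_off_imaginaryAxis {V : Set ℂ} (hV : IsOpen V)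
    {f : ℂ → ℂ} (hc : ContinuousOn f V) (hd : ∀ z ∈ V, z.re ≠ 0 → DifferentiableAt ℂ f z) :
    DifferentiableOn ℂ f V := by
  -- Morera: it suffices that integrals around rectangles vanish. A rectangle straddling the axis is
  -- cut along it, and the two integrals over the cut cancel.
  refine (Complex.isConservativeOn_and_continuousOn_iff_isDifferentiableOn hV).1 ⟨?_, hc⟩
  have side : ∀ z w : ℂ, Complex.Rectangle z w ⊆ V →
      (0 : ℝ) ∉ Set.Ioo (min z.re w.re) (max z.re w.re) →
      (∫ x : ℝ in z.re..w.re, f (x + z.im * Complex.I)) -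
        (∫ x : ℝ in z.re..w.re, f (x + w.im * Complex.I)) +
        Complex.I • (∫ y : ℝ in z.im..w.im, f (w.re + y * Complex.I)) -
        Complex.I • (∫ y : ℝ in z.im..w.im, f (z.re + y * Complex.I)) = 0 := by
    intro z w hzw h0
    refine Complex.integral_boundary_rect_eq_zero_of_continuousOn_of_differentiableOn f z w
      (hc.mono hzw) fun x hx => (hd x (hzw ?_) ?_).differentiableWithinAt
    · exact ⟨Set.Ioo_subset_Icc_self hx.1, Set.Ioo_subset_Icc_self hx.2⟩
    · rintro h
      exact h0 (h ▸ hx.1)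
  intro z w hzw
  rw [← add_eq_zero_iff_eq_neg, Complex.wedgeIntegral_add_wedgeIntegral_eq]
  by_cases h0 : (0 : ℝ) ∈ Set.Ioo (min z.re w.re) (max z.re w.re)
  swap
  · exact side z w hzw h0
  have h0' : (0 : ℝ) ∈ Set.uIcc z.re w.re := Set.Ioo_subset_Icc_self h0
  have sub1 : Set.uIcc z.re 0 ⊆ Set.uIcc z.re w.re := Set.uIcc_subset_uIcc_left h0'
  have sub2 : Set.uIcc 0 w.re ⊆ Set.uIcc z.re w.re := Set.uIcc_subset_uIcc_right h0'
  have e1 := side z (w.im * Complex.I) (fun x hx => hzw ⟨sub1 (by simpa using hx.1),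
    by simpa using hx.2⟩) (by
      simp only [Complex.mul_re, Complex.ofReal_re, Complex.I_re, Complex.ofReal_im,
        Complex.I_im, Set.mem_Ioo]
      rintro ⟨h1, h2⟩
      rcases le_total z.re 0 with h | h <;> simp [h] at h1 h2)
  have e2 := side (z.im * Complex.I) w (fun x hx => hzw ⟨sub2 (by simpa using hx.1),
    by simpa using hx.2⟩) (by
      simp only [Complex.mul_re, Complex.ofReal_re, Complex.I_re, Complex.ofReal_im,
        Complex.I_im, Set.mem_Ioo]
      rintro ⟨h1, h2⟩
      rcases le_total w.re 0 with h | h <;> simp [h] at h1 h2)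
  simp only [Complex.mul_re, Complex.ofReal_re, Complex.I_re, Complex.ofReal_im, Complex.I_im,
    Complex.mul_im, mul_zero, mul_one, sub_zero, add_zero] at e1 e2
  have int : ∀ b ∈ Set.uIcc z.im w.im, ∀ x₁ x₂ : ℝ, Set.uIcc x₁ x₂ ⊆ Set.uIcc z.re w.re →
      IntervalIntegrable (fun x : ℝ => f (x + b * Complex.I)) MeasureTheory.volume x₁ x₂ := by
    intro b hb x₁ x₂ hx
    refine ContinuousOn.intervalIntegrable (hc.comp (by fun_prop) fun x hx' => hzw ⟨?_, ?_⟩)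
    · simpa using hx hx'
    · simpa using hb
  rw [← intervalIntegral.integral_add_adjacent_intervals
      (int z.im Set.left_mem_uIcc _ _ sub1) (int z.im Set.left_mem_uIcc _ _ sub2),
    ← intervalIntegral.integral_add_adjacent_intervals
      (int w.im Set.right_mem_uIcc _ _ sub1) (int w.im Set.right_mem_uIcc _ _ sub2)]
  linear_combination e1 + e2

/-- **Painlevé's theorem** for the unit circle: a continuous function on an open set that is
holomorphic off the circle is holomorphic. -/
theorem differentiableOn_of_continuousOn_of_off_circ {U : Set ℂ} (hU : IsOpen U) {f : ℂ → ℂ}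
    (hc : ContinuousOn f U) (hd : DifferentiableOn ℂ f (U \ circ)) :
    DifferentiableOn ℂ f U := by
  have hopen : IsOpen (U \ circ) := hU.sdiff Metric.isClosed_sphere
  intro t ht
  refine DifferentiableAt.differentiableWithinAt ?_
  by_cases htc : t ∈ circ
  swap
  · exact hd.differentiableAt (hopen.mem_nhds ⟨ht, htc⟩)
  have hnt : ‖t‖ = 1 := by simpa using htc
  have ht0 : t ≠ 0 := by rintro rfl; simp at hnt
  have hcont : Continuous fun w : ℂ => t * Complex.exp w := by fun_prop
  -- As `‖t * exp w‖ = exp (re w)`, this chart turns the circle into the imaginary axis; near `t` it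
  -- is inverted by `log (z / t)`.
  have key : DifferentiableOn ℂ (fun w => f (t * Complex.exp w))
      ((fun w : ℂ => t * Complex.exp w) ⁻¹' U) := by
    refine differentiableOn_of_continuousOn_of_off_imaginaryAxis (hU.preimage hcont)
      (hc.comp hcont.continuousOn fun _ h => h) fun w hw hre => ?_
    refine DifferentiableAt.comp w (hd.differentiableAt (hopen.mem_nhds ⟨hw, ?_⟩)) (by fun_prop)
    simpa [Complex.norm_exp, hnt] using hre
  have hg : DifferentiableAt ℂ (fun w => f (t * Complex.exp w)) (Complex.log (t / t)) :=
    key.differentiableAt ((hU.preimage hcont).mem_nhds (by simpa [ht0] using ht))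
  have hlog : DifferentiableAt ℂ (fun z : ℂ => Complex.log (z / t)) t :=
    DifferentiableAt.clog (by fun_prop) (by simp [ht0])
  refine (DifferentiableAt.comp t hg hlog).congr_of_eventuallyEq ?_
  filter_upwards [eventually_ne_nhds ht0] with z hz
  simp [Complex.exp_log (div_ne_zero hz ht0), mul_div_cancel₀ _ ht0]

theorem circ_compl_eq : circᶜ = {z : ℂ | ‖z‖ < 1} ∪ {z : ℂ | 1 < ‖z‖} := by
  ext z
  simp only [Set.mem_compl_iff, mem_sphere_zero_iff_norm, Set.mem_union, Set.mem_ofPred_eq]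
  exact ne_iff_lt_or_gt

/-- A function holomorphic off the circle whose two boundary values coincide extends
holomorphically across the circle. -/
theorem differentiableOn_piecewise_circ {U : Set ℂ} (hU : IsOpen U) {f b : ℂ → ℂ}
    (hf : DifferentiableOn ℂ f (U \ circ)) (hb : ContinuousOn b (U ∩ circ))
    (hin : ∀ t ∈ U ∩ circ, Tendsto f (𝓝[{z | ‖z‖ < 1}] t) (𝓝 (b t)))
    (hout : ∀ t ∈ U ∩ circ, Tendsto f (𝓝[{z | 1 < ‖z‖}] t) (𝓝 (b t)))
    {F : ℂ → ℂ} (hFb : ∀ t ∈ U ∩ circ, F t = b t) (hFf : ∀ z ∈ U \ circ, F z = f z) :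
    DifferentiableOn ℂ F U := by
  have hd : DifferentiableOn ℂ F (U \ circ) := hf.congr hFf
  have hopen : IsOpen (U \ circ) := hU.sdiff Metric.isClosed_sphere
  refine differentiableOn_of_continuousOn_of_off_circ hU (fun t ht => ?_) hd
  refine ContinuousAt.continuousWithinAt ?_
  by_cases htc : t ∈ circ
  swap
  · exact (hd.differentiableAt (hopen.mem_nhds ⟨ht, htc⟩)).continuousAt
  have h1 : Tendsto F (𝓝[U ∩ circ] t) (𝓝 (F t)) := (hb.congr hFb) t ⟨ht, htc⟩
  rw [nhdsWithin_inter_of_mem (mem_nhdsWithin_of_mem_nhds (hU.mem_nhds ht))] at h1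
  have h2 : Tendsto f (𝓝[circᶜ] t) (𝓝 (F t)) := by
    rw [circ_compl_eq, nhdsWithin_union, hFb t ⟨ht, htc⟩]
    exact (hin t ⟨ht, htc⟩).sup (hout t ⟨ht, htc⟩)
  have h3 : Tendsto F (𝓝[circᶜ] t) (𝓝 (F t)) := by
    refine h2.congr' ?_
    filter_upwards [self_mem_nhdsWithin, mem_nhdsWithin_of_mem_nhds (hU.mem_nhds ht)]
      with z hz hzU using (hFf z ⟨hzU, hz⟩).symm
  rw [ContinuousAt, ← nhdsWithin_univ, ← Set.union_compl_self circ, nhdsWithin_union]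
  exact h1.sup h3

/-! ### Density off the circle and removable singularities -/

theorem nhdsWithin_circ_compl_neBot (t : ℂ) : (𝓝[circᶜ] t).NeBot := by
  rw [← mem_closure_iff_nhdsWithin_neBot, closure_compl, interior_sphere' 0 1]
  simp

theorem zeroSet_finite {A : Polynomial ℂ} (hA : A ≠ 0) : (zeroSet A).Finite := by
  refine (Polynomial.finite_setOfPred_isRoot (mul_ne_zero Polynomial.X_ne_zero hA)).subset ?_
  intro z hz
  simpa [zeroSet, Polynomial.IsRoot] using hz

/-- Finitely many isolated singularities of order `o(1/|z-c|)` of a holomorphic function can be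
removed. -/
theorem exists_entire_extension {S : Set ℂ} (hS : S.Finite) {G : ℂ → ℂ}
    (hG : DifferentiableOn ℂ G Sᶜ) (ho : ∀ c ∈ S, G =o[𝓝[≠] c] fun z => (z - c)⁻¹) :
    ∃ H : ℂ → ℂ, Differentiable ℂ H ∧ ∀ z ∉ S, H z = G z := by
  have hopen : IsOpen Sᶜ := hS.isClosed.isOpen_compl
  have hH : ∀ z ∉ S, limUnder (𝓝[≠] z) G = G z := fun z hz =>
    ((hG.differentiableAt (hopen.mem_nhds hz)).continuousAt.tendsto.mono_left
      nhdsWithin_le_nhds).limUnder_eq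
  refine ⟨fun z => limUnder (𝓝[≠] z) G, fun c => ?_, hH⟩
  by_cases hc : c ∈ S
  swap
  · refine (hG.differentiableAt (hopen.mem_nhds hc)).congr_of_eventuallyEq ?_
    filter_upwards [hopen.mem_nhds hc] with z hz using hH z hz
  have hs : insert c Sᶜ ∈ 𝓝 c := by
    have : (S \ {c})ᶜ ∈ 𝓝 c := (hS.sdiff).isClosed.isOpen_compl.mem_nhds (by simp)
    filter_upwards [this] with z hz
    by_cases h : z = c <;> simp_all
  -- The removability criterion concerns `G - G c`; the value `G c` is arbitrary, but any constant
  -- is `o(1/|z - c|)`.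
  have hconst : (fun _ : ℂ => G c) =o[𝓝[≠] c] fun z => (z - c)⁻¹ := by
    refine isLittleO_const_left.2 (Or.inr ?_)
    refine tendsto_norm_atTop_iff_cobounded.2 (tendsto_inv₀_nhdsNE_zero.comp ?_)
    refine tendsto_nhdsWithin_iff.2 ⟨?_, ?_⟩
    · exact ((continuous_sub_right c).tendsto' c 0 (by simp)).mono_left nhdsWithin_le_nhds
    · filter_upwards [self_mem_nhdsWithin] with z hz
      simpa [sub_eq_zero] using hz
  have := Complex.differentiableOn_update_limUnder_of_isLittleO hs
    (hG.mono fun z hz => (hz.1.resolve_left hz.2)) ((ho c hc).sub hconst)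
  refine (this.differentiableAt hs).congr_of_eventuallyEq ?_
  filter_upwards [hs] with z hz
  by_cases h : z = c
  · subst h; simp
  · rw [Function.update_of_ne h]
    exact hH z (hz.resolve_left h)

/-! ### Calculus of matrix logarithmic derivatives -/

theorem matDeriv_mul {B C : ℂ → Matrix (Fin 2) (Fin 2) ℂ} {z : ℂ}
    (hB : ∀ i j, DifferentiableAt ℂ (fun w => B w i j) z)
    (hC : ∀ i j, DifferentiableAt ℂ (fun w => C w i j) z) :
    matDeriv (fun w => B w * C w) z = matDeriv B z * C z + B z * matDeriv C z := by
  ext i j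
  simp only [matDeriv, Matrix.mul_apply, Fin.sum_univ_two, Matrix.of_apply, Matrix.add_apply]
  rw [deriv_fun_add ((hB i 0).fun_mul (hC 0 j)) ((hB i 1).fun_mul (hC 1 j)),
    deriv_fun_mul (hB i 0) (hC 0 j), deriv_fun_mul (hB i 1) (hC 1 j)]
  ring

theorem differentiableAt_mul_apply {B C : ℂ → Matrix (Fin 2) (Fin 2) ℂ} {z : ℂ}
    (hB : ∀ i j, DifferentiableAt ℂ (fun w => B w i j) z)
    (hC : ∀ i j, DifferentiableAt ℂ (fun w => C w i j) z) (i j : Fin 2) :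
    DifferentiableAt ℂ (fun w => (B w * C w) i j) z := by
  simp only [Matrix.mul_apply, Fin.sum_univ_two]
  exact ((hB i 0).fun_mul (hC 0 j)).fun_add ((hB i 1).fun_mul (hC 1 j))

theorem matDeriv_congr {B C : ℂ → Matrix (Fin 2) (Fin 2) ℂ} {z : ℂ} (h : B =ᶠ[𝓝 z] C) :
    matDeriv B z = matDeriv C z := by
  ext i j
  refine EventuallyEq.deriv_eq (f := fun w => C w i j) ?_
  filter_upwards [h] with w hw
  rw [hw]

/-- `Y' adj(Y) + g Y diag(1, -1) adj(Y)`: the logarithmic derivative of `Y diag(α, α⁻¹)` when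
`det Y = 1` and `α' = g α`. -/
noncomputable def twistedLogDeriv (g : ℂ → ℂ) (Y : ℂ → Matrix (Fin 2) (Fin 2) ℂ) (z : ℂ) :
    Matrix (Fin 2) (Fin 2) ℂ :=
  matDeriv Y z * (Y z).adjugate + g z • (Y z * !![1, 0; 0, -1] * (Y z).adjugate)

theorem twistedLogDeriv_congr {g : ℂ → ℂ} {B C : ℂ → Matrix (Fin 2) (Fin 2) ℂ} {z : ℂ}
    (h : B =ᶠ[𝓝 z] C) : twistedLogDeriv g B z = twistedLogDeriv g C z := by
  rw [twistedLogDeriv, twistedLogDeriv, matDeriv_congr h, h.eq_of_nhds]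

/-- With the adjugate in place of the inverse, the expression is polynomial in `g` and the entries
of `Y` and `Y'`, so no condition on the determinant is needed. -/
theorem differentiableAt_twistedLogDeriv {g : ℂ → ℂ} {Y : ℂ → Matrix (Fin 2) (Fin 2) ℂ}
    {U : Set ℂ} (hU : IsOpen U) (hY : ∀ i j, DifferentiableOn ℂ (fun w => Y w i j) U) {z : ℂ}
    (hz : z ∈ U) (hg : DifferentiableAt ℂ g z) (i j : Fin 2) :
    DifferentiableAt ℂ (fun w => twistedLogDeriv g Y w i j) z := by
  have hY' : ∀ i j, DifferentiableAt ℂ (fun w => Y w i j) z := fun i j =>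
    (hY i j).differentiableAt (hU.mem_nhds hz)
  have hD : ∀ i j, DifferentiableAt ℂ (fun w => matDeriv Y w i j) z := fun i j =>
    ((hY i j).deriv hU).differentiableAt (hU.mem_nhds hz)
  have hadj : ∀ i j, DifferentiableAt ℂ (fun w => (Y w).adjugate i j) z := by
    intro i j
    simp only [Matrix.adjugate_fin_two]
    fin_cases i <;> fin_cases j <;> simp [hY']
  have hmid : ∀ i j, DifferentiableAt ℂ (fun w =>
      (Y w * (!![1, 0; 0, -1] : Matrix (Fin 2) (Fin 2) ℂ) * (Y w).adjugate) i j) z := fun i j =>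
    differentiableAt_mul_apply (differentiableAt_mul_apply hY' fun i j =>
      differentiableAt_const ((!![1, 0; 0, -1] : Matrix (Fin 2) (Fin 2) ℂ) i j)) hadj i j
  exact (differentiableAt_mul_apply hD hadj i j).fun_add (hg.fun_mul (hmid i j))

/-- Right multiplication by `[1, h; 0, 1]` with `h' = 2 g h` does not change `twistedLogDeriv`. -/
theorem twistedLogDeriv_mul_unipotent {g h : ℂ → ℂ} {Y : ℂ → Matrix (Fin 2) (Fin 2) ℂ} {z : ℂ}
    (hY : ∀ i j, DifferentiableAt ℂ (fun w => Y w i j) z)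
    (hh : HasDerivAt h (2 * g z * h z) z) :
    twistedLogDeriv g (fun w => Y w * !![1, h w; 0, 1]) z = twistedLogDeriv g Y z := by
  have hJ : ∀ i j, DifferentiableAt ℂ (fun w => !![1, h w; 0, 1] i j) z := by
    intro i j
    fin_cases i <;> fin_cases j <;> simp [hh.differentiableAt]
  have hJ' : matDeriv (fun w => !![1, h w; 0, 1]) z = !![0, 2 * g z * h z; 0, 0] := by
    ext i j
    fin_cases i <;> fin_cases j <;> simp [matDeriv, hh.deriv]
  rw [twistedLogDeriv, twistedLogDeriv, matDeriv_mul hY hJ, hJ']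
  generalize matDeriv Y z = D
  generalize Y z = B
  ext i j
  fin_cases i <;> fin_cases j <;>
    simp [Matrix.adjugate_fin_two, Matrix.mul_apply, Fin.sum_univ_two] <;> ring

/-- The diagonal factor has determinant one and logarithmic derivative `g diag(1,-1)`; conjugating
the latter by `Y` produces the second term of `twistedLogDeriv`. -/
theorem matDeriv_mul_diagonal_mul_inv {g α : ℂ → ℂ} {Y : ℂ → Matrix (Fin 2) (Fin 2) ℂ} {z : ℂ}
    (hY : ∀ i j, DifferentiableAt ℂ (fun w => Y w i j) z) (hdet : (Y z).det = 1)
    (hα : HasDerivAt α (g z * α z) z) (h0 : α z ≠ 0) :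
    (∀ i j, DifferentiableAt ℂ (fun w => (Y w * !![α w, 0; 0, (α w)⁻¹]) i j) z) ∧
      IsUnit (Y z * !![α z, 0; 0, (α z)⁻¹]).det ∧
      twistedLogDeriv g Y z = matDeriv (fun w => Y w * !![α w, 0; 0, (α w)⁻¹]) z *
        (Y z * !![α z, 0; 0, (α z)⁻¹])⁻¹ := by
  have hC : ∀ i j, DifferentiableAt ℂ (fun w => !![α w, 0; 0, (α w)⁻¹] i j) z := by
    intro i j
    fin_cases i <;> fin_cases j <;>
      simp [hα.differentiableAt, hα.differentiableAt.fun_inv h0]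
  have hC' : matDeriv (fun w => !![α w, 0; 0, (α w)⁻¹]) z =
      !![g z * α z, 0; 0, -(g z * (α z)⁻¹)] := by
    ext i j
    fin_cases i <;> fin_cases j <;>
      simp [matDeriv, hα.deriv, (hα.fun_inv h0).deriv]
    field_simp
  have hdetZ : (Y z * !![α z, 0; 0, (α z)⁻¹]).det = 1 := by
    rw [Matrix.det_mul, hdet, Matrix.det_fin_two_of, mul_inv_cancel₀ h0]
    ring
  refine ⟨differentiableAt_mul_apply hY hC, by rw [hdetZ]; exact isUnit_one, ?_⟩
  rw [Matrix.inv_def, hdetZ, Ring.inverse_one, one_smul, matDeriv_mul hY hC, hC', twistedLogDeriv]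
  generalize matDeriv Y z = D
  generalize Y z = B
  ext i j
  fin_cases i <;> fin_cases j <;>
    simp [Matrix.adjugate_fin_two, Matrix.mul_apply, Fin.sum_univ_two] <;> field_simp <;> ring

/-! ### The determinant -/

/-- A solution of the Riemann–Hilbert problem has determinant one. -/
theorem IsRHSolution.det_eq_one {n : ℕ} {ν : ℂ → ℂ} {S : Set ℂ}
    {Y : ℂ → Matrix (Fin 2) (Fin 2) ℂ} (hY : IsRHSolution n ν S Y) (hS : S.Finite)
    (hSc : S ⊆ circ) {z : ℂ} (hz : z ∉ circ) : (Y z).det = 1 := by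
  classical
  obtain ⟨Yp, Ym, hYp, -, hjump⟩ := hY.jump
  have hdetc : Continuous fun B : Matrix (Fin 2) (Fin 2) ℂ => B.det := continuous_id.matrix_det
  let G : ℂ → ℂ := fun z => if z ∈ circ then (Yp z).det else (Y z).det
  have hGc : ∀ z ∈ circ, G z = (Yp z).det := fun z hz => if_pos hz
  have hGn : ∀ z ∉ circ, G z = (Y z).det := fun z hz => if_neg hz
  have hopen : IsOpen Sᶜ := hS.isClosed.isOpen_compl
  have hGd : DifferentiableOn ℂ G Sᶜ := by
    refine differentiableOn_piecewise_circ hopen (f := fun z => (Y z).det)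
      (b := fun z => (Yp z).det) ?_ ?_ ?_ ?_ (fun t ht => hGc t ht.2) (fun z hz => hGn z hz.2)
    · simp only [Matrix.det_fin_two]
      exact (((hY.holomorphic 0 0).fun_mul (hY.holomorphic 1 1)).fun_sub
        ((hY.holomorphic 0 1).fun_mul (hY.holomorphic 1 0))).mono fun z hz => hz.2
    · exact hdetc.comp_continuousOn (hYp.mono fun z hz => ⟨hz.2, hz.1⟩)
    · exact fun t ht => (hdetc.tendsto _).comp (hjump t ⟨ht.2, ht.1⟩).1
    · intro t ht
      obtain ⟨-, hm, he⟩ := hjump t ⟨ht.2, ht.1⟩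
      have : (Yp t).det = (Ym t).det := by
        rw [he, Matrix.det_mul, Matrix.det_fin_two_of]; simp
      simpa only [this, Function.comp_def] using (hdetc.tendsto _).comp hm
  have hGo : ∀ c ∈ S, G =o[𝓝[≠] c] fun z => (z - c)⁻¹ := by
    intro c hc
    -- Each product in the determinant pairs a first-column entry, `O(1)`, with a second-column
    -- entry.
    have ho : (fun z => (Y z).det) =o[𝓝[circᶜ] c] fun z => (z - c)⁻¹ := by
      simp only [Matrix.det_fin_two]
      have h1 := (hY.endpoint c hc 0).1.mul_isLittleO (hY.endpoint c hc 1).2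
      have h2 := (hY.endpoint c hc 1).1.mul_isLittleO (hY.endpoint c hc 0).2
      refine ((h1.sub h2).congr_left fun z => ?_).congr_right fun z => one_mul _
      ring
    -- The endpoint bound is known only off the circle. At nearby circle points it follows by
    -- continuity of `G`, since the complement of the circle is dense.
    refine isLittleO_iff.2 fun ε hε => ?_
    have hev := isLittleO_iff.1 ho hε
    rw [eventually_nhdsWithin_iff, eventually_nhds_iff] at hev
    obtain ⟨V, hV, hVo, hcV⟩ := hev
    have hSV : (S \ {c})ᶜ ∈ 𝓝 c := (hS.sdiff).isClosed.isOpen_compl.mem_nhds (by simp)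
    filter_upwards [mem_nhdsWithin_of_mem_nhds (hVo.mem_nhds hcV),
      mem_nhdsWithin_of_mem_nhds hSV, self_mem_nhdsWithin] with t htV htS htc
    have htc' : t - c ≠ 0 := sub_ne_zero.2 htc
    have htS' : t ∈ Sᶜ := fun h => htS ⟨h, htc⟩
    have hcontG : ContinuousAt G t :=
      (hGd.differentiableAt (hopen.mem_nhds htS')).continuousAt
    have hcontI : ContinuousAt (fun z : ℂ => ε * ‖(z - c)⁻¹‖) t := by
      have : ContinuousAt (fun z : ℂ => (z - c)⁻¹) t :=
        ContinuousAt.inv₀ (by fun_prop) htc'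
      exact continuousAt_const.mul this.norm
    have := nhdsWithin_circ_compl_neBot t
    refine le_of_tendsto_of_tendsto (hcontG.norm.tendsto.mono_left nhdsWithin_le_nhds)
      (hcontI.tendsto.mono_left (nhdsWithin_le_nhds (s := circᶜ))) ?_
    filter_upwards [self_mem_nhdsWithin, mem_nhdsWithin_of_mem_nhds (hVo.mem_nhds htV)]
      with w hw hwV
    rw [hGn w hw]
    exact hV w hwV hw
  obtain ⟨H, hHd, hH⟩ := exists_entire_extension hS hGd hGo
  have hlim : Tendsto H (cocompact ℂ) (𝓝 1) := by
    rw [← Metric.cobounded_eq_cocompact]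
    obtain ⟨R, hR, hYR⟩ := hY.infinity
    have hR0 : Tendsto R (Bornology.cobounded ℂ) (𝓝 0) := by
      refine tendsto_pi_nhds.2 fun i => tendsto_pi_nhds.2 fun j => ?_
      exact (hR i j).trans_tendsto tendsto_inv₀_cobounded
    have hdet1 : Tendsto (fun z => (1 + R z).det) (Bornology.cobounded ℂ) (𝓝 1) := by
      have := (hdetc.tendsto _).comp (hR0.const_add 1)
      simpa [Function.comp_def] using this
    refine hdet1.congr' ?_
    filter_upwards [hYR, tendsto_norm_cobounded_atTop.eventually_gt_atTop 1] with w hw hw1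
    have hwc : w ∉ circ := by simpa using hw1.ne'
    have hw0 : w ≠ 0 := norm_pos_iff.1 (zero_lt_one.trans hw1)
    rw [hH w (fun h => hwc (hSc h)), hGn w hwc, hw, Matrix.det_mul, Matrix.det_fin_two_of,
      mul_inv_cancel₀ (pow_ne_zero n hw0)]
    ring
  rw [← hGn z hz, ← hH z (fun h => hz (hSc h))]
  exact hHd.apply_eq_of_tendsto_cocompact z hlim

/-! ### Consequences of the Pearson equation -/

/-- Half of the logarithmic derivative of `ν(z) / z ^ n`. -/
noncomputable def halfLogDeriv (A : Polynomial ℂ) (q : ℂ → ℂ) (n : ℕ) (z : ℂ) : ℂ :=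
  (q z / (z * A.eval z) - n / z) / 2

theorem differentiableAt_halfLogDeriv {A : Polynomial ℂ} {q : ℂ → ℂ} (hq : Differentiable ℂ q)
    (n : ℕ) {z : ℂ} (hz : z ∉ zeroSet A) : DifferentiableAt ℂ (halfLogDeriv A q n) z := by
  have hz' : z * A.eval z ≠ 0 := hz
  have hz0 : z ≠ 0 := left_ne_zero_of_mul hz'
  have hA : DifferentiableAt ℂ (fun w => w * A.eval w) z :=
    differentiableAt_id.fun_mul A.differentiable.differentiableAt
  exact (((hq z).fun_div hA hz').fun_sub
    ((differentiableAt_const _).fun_div differentiableAt_id hz0)).div_const 2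

namespace IsGeneralizedSemiclassical

variable {A : Polynomial ℂ} {q ν : ℂ → ℂ} {Ω : Set ℂ}

theorem ne_zero_of_mem (hν : IsGeneralizedSemiclassical A q ν Ω) {z : ℂ} (hz : z ∈ Ω) : z ≠ 0 :=
  left_ne_zero_of_mul (b := A.eval z) (hν.subset_compl hz)

theorem hasDerivAt_div_pow (hν : IsGeneralizedSemiclassical A q ν Ω) (n : ℕ) {z : ℂ}
    (hz : z ∈ Ω) :
    HasDerivAt (fun w => ν w / w ^ n) (2 * halfLogDeriv A q n z * (ν z / z ^ n)) z := by
  have hz0 := hν.ne_zero_of_mem hz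
  have hzA : z * A.eval z ≠ 0 := hν.subset_compl hz
  have hd : HasDerivAt ν (q z / (z * A.eval z) * ν z) z := by
    have := (hν.holomorphic.differentiableAt (hν.isOpen.mem_nhds hz)).hasDerivAt
    refine this.congr_deriv ?_
    symm
    rw [div_mul_eq_mul_div, div_eq_iff hzA, ← hν.pearson z hz]
    ring
  refine (hd.fun_div (hasDerivAt_pow n z) (pow_ne_zero n hz0)).congr_deriv ?_
  -- The derivative of `w ^ n` carries the truncated exponent `n - 1`, so `n = 0` is separate.
  rcases n with _ | n
  · simp [halfLogDeriv, mul_div_cancel₀]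
  · have hA0 : A.eval z ≠ 0 := right_ne_zero_of_mul hzA
    simp only [halfLogDeriv, Nat.add_sub_cancel]
    field_simp
    ring

/-- The diagonal entry `z^{-n/2} ν^{1/2}` satisfies `α' = g α`, whatever the branches. -/
theorem hasDerivAt_sqrt (hν : IsGeneralizedSemiclassical A q ν Ω) (n : ℕ) {z : ℂ} (hz : z ∈ Ω)
    {r s : ℂ → ℂ} (hr : IsSqrtBranchAt (fun w => w) r z) (hs : IsSqrtBranchAt ν s z) :
    (r z ^ n)⁻¹ / (s z)⁻¹ ≠ 0 ∧ HasDerivAt (fun w => (r w ^ n)⁻¹ / (s w)⁻¹)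
      (halfLogDeriv A q n z * ((r z ^ n)⁻¹ / (s z)⁻¹)) z := by
  have hr0 : r z ≠ 0 := by
    intro h
    have := hr.2.self_of_nhds
    simp only [h] at this
    exact hν.ne_zero_of_mem hz (by simpa using this.symm)
  have hs0 : s z ≠ 0 := by
    intro h
    have := hs.2.self_of_nhds
    simp only [h] at this
    exact hν.weight_ne_zero z hz (by simpa using this.symm)
  have h0 : (r z ^ n)⁻¹ / (s z)⁻¹ ≠ 0 :=
    div_ne_zero (inv_ne_zero (pow_ne_zero n hr0)) (inv_ne_zero hs0)
  have hd : DifferentiableAt ℂ (fun w => (r w ^ n)⁻¹ / (s w)⁻¹) z :=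
    ((hr.1.differentiableAt.fun_pow n).fun_inv (pow_ne_zero n hr0)).fun_div
      (hs.1.differentiableAt.fun_inv hs0) (inv_ne_zero hs0)
  have hsq : ∀ᶠ w in 𝓝 z, ((r w ^ n)⁻¹ / (s w)⁻¹) ^ 2 = ν w / w ^ n := by
    filter_upwards [hr.2, hs.2] with w h1 h2
    rw [div_inv_eq_mul, mul_pow, inv_pow, ← pow_mul, mul_comm n 2, pow_mul, h1, h2]
    ring
  refine ⟨h0, ?_⟩
  -- Only the square of the entry is known; differentiate it in two ways and cancel twice the entry.
  have e1 := hd.hasDerivAt.fun_pow 2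
  have e2 := (hν.hasDerivAt_div_pow n hz).congr_of_eventuallyEq hsq
  have e := e1.unique e2
  rw [← hsq.self_of_nhds] at e
  refine hd.hasDerivAt.congr_deriv ?_
  refine mul_left_cancel₀ (mul_ne_zero two_ne_zero h0) ?_
  linear_combination (norm := (push_cast; ring)) e

end IsGeneralizedSemiclassical

/-! ### Continuation across the circle -/

open Classical in
/-- The continuation across the circle of the interior solution: outside the disk the jump is
undone by the holomorphic weight. -/
noncomputable def continuation (n : ℕ) (ν : ℂ → ℂ) (Y Yp : ℂ → Matrix (Fin 2) (Fin 2) ℂ) (z : ℂ) :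
    Matrix (Fin 2) (Fin 2) ℂ :=
  if ‖z‖ < 1 then Y z else if 1 < ‖z‖ then Y z * !![1, ν z / z ^ n; 0, 1] else Yp z

theorem continuation_of_lt {n : ℕ} {ν : ℂ → ℂ} {Y Yp : ℂ → Matrix (Fin 2) (Fin 2) ℂ} {z : ℂ}
    (hz : ‖z‖ < 1) : continuation n ν Y Yp z = Y z := if_pos hz

theorem continuation_of_gt {n : ℕ} {ν : ℂ → ℂ} {Y Yp : ℂ → Matrix (Fin 2) (Fin 2) ℂ} {z : ℂ}
    (hz : 1 < ‖z‖) : continuation n ν Y Yp z = Y z * !![1, ν z / z ^ n; 0, 1] := by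
  rw [continuation, if_neg hz.le.not_gt, if_pos hz]

theorem continuation_of_eq {n : ℕ} {ν : ℂ → ℂ} {Y Yp : ℂ → Matrix (Fin 2) (Fin 2) ℂ} {z : ℂ}
    (hz : ‖z‖ = 1) : continuation n ν Y Yp z = Yp z := by
  rw [continuation, if_neg hz.ge.not_gt, if_neg hz.le.not_gt]

theorem isOpen_norm_gt_one : IsOpen {z : ℂ | 1 < ‖z‖} := isOpen_lt continuous_const continuous_norm

theorem isOpen_norm_lt_one : IsOpen {z : ℂ | ‖z‖ < 1} := isOpen_lt continuous_norm continuous_const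

section

variable {A : Polynomial ℂ} {q ν : ℂ → ℂ} {Ω S : Set ℂ} {n : ℕ}
  {Y Yp Ym : ℂ → Matrix (Fin 2) (Fin 2) ℂ}

theorem IsRHSolution.differentiableAt (hY : IsRHSolution n ν S Y) {z : ℂ} (hz : z ∉ circ)
    (i j : Fin 2) : DifferentiableAt ℂ (fun w => Y w i j) z :=
  (hY.holomorphic i j).differentiableAt (Metric.isClosed_sphere.isOpen_compl.mem_nhds hz)

theorem IsRHSolution.differentiableOn_continuation (hY : IsRHSolution n ν S Y)
    (hν : IsGeneralizedSemiclassical A q ν Ω) (hSΩ : Disjoint S Ω)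
    (hYp : ContinuousOn Yp (circ \ S))
    (hjump : ∀ t ∈ circ \ S,
      Tendsto Y (𝓝[{z | ‖z‖ < 1}] t) (𝓝 (Yp t)) ∧
      Tendsto Y (𝓝[{z | 1 < ‖z‖}] t) (𝓝 (Ym t)) ∧
      Yp t = Ym t * !![1, ν t / t ^ n; 0, 1]) (i j : Fin 2) :
    DifferentiableOn ℂ (fun z => continuation n ν Y Yp z i j) Ω := by
  have hmem : ∀ t ∈ Ω ∩ circ, t ∈ circ \ S := fun t ht =>
    ⟨ht.2, fun h => hSΩ.le_bot ⟨h, ht.1⟩⟩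
  refine differentiableOn_piecewise_circ hν.isOpen (f := fun z => continuation n ν Y Yp z i j)
    (b := fun z => Yp z i j) ?_ ?_ ?_ ?_
    (fun t ht => ?_) (fun z _ => rfl)
  · rintro z ⟨hzΩ, hzc⟩
    refine DifferentiableAt.differentiableWithinAt ?_
    have hd := hY.differentiableAt hzc
    rw [← Set.mem_compl_iff, circ_compl_eq] at hzc
    rcases hzc with hz | hz
    · refine (hd i j).congr_of_eventuallyEq ?_
      filter_upwards [isOpen_norm_lt_one.mem_nhds hz] with w hw
      rw [continuation_of_lt hw]
    · have hJ : ∀ i j, DifferentiableAt ℂ (fun w => !![1, ν w / w ^ n; 0, 1] i j) z := by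
        intro i j
        fin_cases i <;> fin_cases j <;> simp [(hν.hasDerivAt_div_pow n hzΩ).differentiableAt]
      refine (differentiableAt_mul_apply hd hJ i j).congr_of_eventuallyEq ?_
      filter_upwards [isOpen_norm_gt_one.mem_nhds hz] with w hw
      rw [continuation_of_gt hw]
  · exact (continuous_id.matrix_elem i j).comp_continuousOn (hYp.mono hmem)
  · intro t ht
    refine (((continuous_id.matrix_elem i j).tendsto _).comp (hjump t (hmem t ht)).1).congr' ?_
    filter_upwards [self_mem_nhdsWithin] with w hw
    rw [continuation_of_lt hw]
    rfl
  · intro t ht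
    obtain ⟨-, hm, he⟩ := hjump t (hmem t ht)
    -- The exterior limit is `Ym t` times the jump matrix, which is `Yp t`: both sides share one
    -- boundary value.
    have hJ : ContinuousAt (fun w : ℂ => !![1, ν w / w ^ n; 0, 1]) t := by
      refine continuousAt_pi.2 fun i => continuousAt_pi.2 fun j => ?_
      fin_cases i <;> fin_cases j <;>
        simp [continuousAt_const, (hν.hasDerivAt_div_pow n ht.1).continuousAt]
    have hprod := hm.mul (hJ.tendsto.mono_left (nhdsWithin_le_nhds (s := {z : ℂ | 1 < ‖z‖})))
    rw [← he] at hprod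
    refine (((continuous_id.matrix_elem i j).tendsto _).comp hprod).congr' ?_
    filter_upwards [self_mem_nhdsWithin] with w hw
    rw [continuation_of_gt hw]
    rfl
  · rw [continuation_of_eq (by simpa using ht.2)]

theorem IsRHSolution.twistedLogDeriv_continuation (hY : IsRHSolution n ν S Y)
    (hν : IsGeneralizedSemiclassical A q ν Ω) {z : ℂ} (hz : z ∈ Ω) (hzc : z ∉ circ) :
    twistedLogDeriv (halfLogDeriv A q n) (continuation n ν Y Yp) z =
      twistedLogDeriv (halfLogDeriv A q n) Y z := by
  have hd := hY.differentiableAt hzc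
  rw [← Set.mem_compl_iff, circ_compl_eq] at hzc
  rcases hzc with hzn | hzn
  · refine twistedLogDeriv_congr ?_
    filter_upwards [isOpen_norm_lt_one.mem_nhds hzn] with w hw using continuation_of_lt hw
  · rw [← twistedLogDeriv_mul_unipotent hd (hν.hasDerivAt_div_pow n hz)]
    refine twistedLogDeriv_congr ?_
    filter_upwards [isOpen_norm_gt_one.mem_nhds hzn] with w hw using continuation_of_gt hw

end

end UnitCircleRH

/-- The structure matrix `M_n = Z_n' Z_n⁻¹` is holomorphic off the zeros of `z A(z)`, across the unit
circle: there is one function `M`, holomorphic on the complement of `zeroSet A`, that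
equals `Z_n' Z_n⁻¹` at every point off the circle where `Z_n` is defined, whichever branches of the
square roots are used in `Z_n`. -/
theorem mainTheorem1 (A : Polynomial ℂ) (q ν : ℂ → ℂ) (Ω : Set ℂ)
    (hν : IsGeneralizedSemiclassical A q ν Ω)
    (S : Set ℂ) (hS : S ⊆ circ ∩ zeroSet A)
    (n : ℕ) (Y : ℂ → Matrix (Fin 2) (Fin 2) ℂ) (hY : IsRHSolution n ν S Y) :
    ∃ M : ℂ → Matrix (Fin 2) (Fin 2) ℂ,
      (∀ z ∈ Ω \ circ, ∀ r s : ℂ → ℂ,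
        IsSqrtBranchAt (fun w => w) r z → IsSqrtBranchAt ν s z →
          (∀ i j, DifferentiableAt ℂ (fun w => zMatrix n Y r s w i j) z) ∧
          IsUnit (zMatrix n Y r s z).det ∧
          M z = matDeriv (zMatrix n Y r s) z * (zMatrix n Y r s z)⁻¹) ∧
      (∀ i j, DifferentiableOn ℂ (fun z => M z i j) (zeroSet A)ᶜ) ∧
      (∀ a ∈ zeroSet A, ∀ᶠ z in 𝓝[≠] a, ∀ i j, DifferentiableAt ℂ (fun w => M w i j) z) := by
  classical
  have hfin : (zeroSet A).Finite := zeroSet_finite hν.ne_zero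
  have hopenA : IsOpen (zeroSet A)ᶜ := hfin.isClosed.isOpen_compl
  have hSfin : S.Finite := hfin.subset fun z hz => (hS hz).2
  have hSΩ : Disjoint S Ω :=
    Set.disjoint_left.2 fun z hz hzΩ => hν.subset_compl hzΩ (hS hz).2
  obtain ⟨Yp, Ym, hYp, -, hjump⟩ := hY.jump
  have hW := hY.differentiableOn_continuation hν hSΩ hYp hjump
  let g := halfLogDeriv A q n
  -- Off the circle `Y` itself is used, because the continuation involves `ν`, which is uncontrolled
  -- outside `Ω`. On `Ω` the two formulas agree, which gives regularity on the circle.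
  let M : ℂ → Matrix (Fin 2) (Fin 2) ℂ := fun z =>
    if z ∈ circ then twistedLogDeriv g (continuation n ν Y Yp) z else twistedLogDeriv g Y z
  have hMn : ∀ z ∉ circ, M z = twistedLogDeriv g Y z := fun z hz => if_neg hz
  have hMΩ : ∀ z ∈ Ω, M z = twistedLogDeriv g (continuation n ν Y Yp) z := by
    intro z hz
    by_cases hzc : z ∈ circ
    · exact if_pos hzc
    · rw [hMn z hzc, hY.twistedLogDeriv_continuation hν hz hzc]
  have hM : ∀ z ∉ zeroSet A, ∀ i j, DifferentiableAt ℂ (fun w => M w i j) z := by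
    intro z hzA i j
    have hg := differentiableAt_halfLogDeriv hν.entire n hzA
    by_cases hzc : z ∈ circ
    · have hzΩ := hν.circ_subset ⟨hzc, hzA⟩
      refine (differentiableAt_twistedLogDeriv hν.isOpen hW hzΩ hg i j).congr_of_eventuallyEq ?_
      filter_upwards [hν.isOpen.mem_nhds hzΩ] with w hw
      rw [hMΩ w hw]
    · have hopen : IsOpen circᶜ := Metric.isClosed_sphere.isOpen_compl
      refine (differentiableAt_twistedLogDeriv hopen hY.holomorphic hzc hg
        i j).congr_of_eventuallyEq ?_
      filter_upwards [hopen.mem_nhds hzc] with w hw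
      rw [hMn w hw]
  refine ⟨M, ?_, fun i j z hz => (hM z hz i j).differentiableWithinAt, ?_⟩
  · rintro z ⟨hzΩ, hzc⟩ r s hr hs
    obtain ⟨h0, hα⟩ := hν.hasDerivAt_sqrt n hzΩ hr hs
    have hdet := hY.det_eq_one hSfin (fun w hw => (hS hw).1) hzc
    have hZ : zMatrix n Y r s = fun w => Y w *
        !![(r w ^ n)⁻¹ / (s w)⁻¹, 0; 0, ((r w ^ n)⁻¹ / (s w)⁻¹)⁻¹] := by
      funext w
      rw [zMatrix, cMatrix, inv_div_inv, inv_div]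
    rw [hMn z hzc, hZ]
    exact matDeriv_mul_diagonal_mul_inv (hY.differentiableAt hzc) hdet hα h0
  · intro a _
    have : (zeroSet A \ {a})ᶜ ∈ 𝓝 a := hfin.sdiff.isClosed.isOpen_compl.mem_nhds (by simp)
    filter_upwards [mem_nhdsWithin_of_mem_nhds this, self_mem_nhdsWithin] with z hz hza
    exact hM z fun h => hz ⟨h, hza⟩
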